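/- **Theorem.** Let $A\in\mathbb R^{n\times n}$ ($n\ge 1$) have all entries positive. For a vector $y\in\mathbb R^n$ with positive entries let $Uy=1./y$ be the entrywise reciprocal, $Sy=UAy$, $Ty=UA^TUAy$, and let $J_T(y)$ be the Jacobian matrix of $T$ at $y$. Let $\ell\ge 1$ be an integer, let $x^{(0)}\in\mathbb R^n$ have positive entries, and let $\{x^{(k)}\}_k$ be the sequence generated by SKK$_\ell$ from $x^{(0)}$, i.e. $$v^{(k+1)}=J_T(x^{(k)})^{\ell}\,x^{(k)},\qquad x^{(k+1)}=\frac{v^{(k+1)}}{e^Tv^{(k+1)}},\qquad k\ge 0,\qquad e=(1,\dots,1)^T .$$ Let $x\in\mathbb R^n$ have positive entries and satisfy $x=Tx$ and $e^Tx=1$. Let $\sigma_2$ be the second largest singular value (counted with multiplicity) of the balanced matrix $P=\operatorname{diag}(Sx)\,A\,\operatorname{diag}(x)$, with $\sigma_2=0$ if $n=1$. Write $\|\cdot\|_2$ for the Euclidean norm of vectors and the spectral norm of matrices, and put $0^0=1$. Assume that 1. there are $\eta>0$ and matrices $E_k$ such that $J_T(x^{(k)})^{\ell}=J_T(x)^{\ell}+E_k$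 and $\|E_k\|_2\le \eta\,\sigma_2^{2\ell k}$ for all $k\ge 0$; 2. there is $\gamma>0$ such that $\|J_T(x^{(m)})^{\ell}\cdots J_T(x^{(1)})^{\ell}J_T(x^{(0)})^{\ell}\|_2\ge\gamma$ for all $m\ge 0$. Then $$\lim_{k\to\infty}x^{(k)}=x\qquad\text{and}\qquad \limsup_{k\to\infty}\|x^{(k)}-x\|_2^{1/k}\le\sigma_2^{2\ell}.$$ -/

import Mathlib

open Filter Topology
open scoped Matrix Matrix.Norms.L2Operator

noncomputable section

namespace SKK

variable {n : ℕ}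

/-- The entrywise reciprocal `U x = 1 ./ x` (used below only at vectors with positive entries). -/
def opU (x : Fin n → ℝ) : Fin n → ℝ := fun i => (x i)⁻¹

/-- The operator `S x = U A x`. -/
def opS (A : Matrix (Fin n) (Fin n) ℝ) (x : Fin n → ℝ) : Fin n → ℝ := opU (A *ᵥ x)

/-- Menon's operator `T x = U Aᵀ U A x`. For a matrix `A` with positive entries it maps vectors with
positive entries to vectors with positive entries, and no reciprocal of `0` occurs there. -/
def opT (A : Matrix (Fin n) (Fin n) ℝ) (x : Fin n → ℝ) : Fin n → ℝ := opU (Aᵀ *ᵥ opU (A *ᵥ x))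

/-- The Jacobian matrix `J_T(z)` of `T` at `z`: the `(i, j)` entry is `∂T_i/∂z_j (z)`. -/
def jacobian (A : Matrix (Fin n) (Fin n) ℝ) (z : Fin n → ℝ) : Matrix (Fin n) (Fin n) ℝ :=
  LinearMap.toMatrix' (fderiv ℝ (opT A) z : (Fin n → ℝ) →ₗ[ℝ] (Fin n → ℝ))

/-- The iterates of SKK_ℓ started at `x₀`: `x⁽⁰⁾ = x₀`, `v⁽ᵏ⁺¹⁾ = J_T(x⁽ᵏ⁾)^ℓ x⁽ᵏ⁾` and
`x⁽ᵏ⁺¹⁾ = v⁽ᵏ⁺¹⁾ / (eᵀ v⁽ᵏ⁺¹⁾)`, where `e` is the all-ones vector. -/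
def iter (A : Matrix (Fin n) (Fin n) ℝ) (ℓ : ℕ) (x₀ : Fin n → ℝ) : ℕ → (Fin n → ℝ)
  | 0 => x₀
  | k + 1 =>
    let v : Fin n → ℝ := (jacobian A (iter A ℓ x₀ k)) ^ ℓ *ᵥ iter A ℓ x₀ k
    (∑ i, v i)⁻¹ • v

/-- The product `J_T(x⁽ᵐ⁾)^ℓ ⋯ J_T(x⁽¹⁾)^ℓ J_T(x⁽⁰⁾)^ℓ` along the iterates of SKK_ℓ, later factors
on the left. -/
def jacProd (A : Matrix (Fin n) (Fin n) ℝ) (ℓ : ℕ) (x₀ : Fin n → ℝ) : ℕ → Matrix (Fin n) (Fin n) ℝ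
  | 0 => (jacobian A (iter A ℓ x₀ 0)) ^ ℓ
  | m + 1 => (jacobian A (iter A ℓ x₀ (m + 1))) ^ ℓ * jacProd A ℓ x₀ m

/-- The balanced matrix `P = D(S x) A D(x)`. -/
def balanced (A : Matrix (Fin n) (Fin n) ℝ) (x : Fin n → ℝ) : Matrix (Fin n) (Fin n) ℝ :=
  Matrix.diagonal (opS A x) * A * Matrix.diagonal x

/-- The second largest singular value (with multiplicity) of a square matrix. Mathlib's sequence of
singular values is decreasing and indexed from `0`; for `n = 1` the value is `0`. -/
def sigmaTwo (M : Matrix (Fin n) (Fin n) ℝ) : ℝ :=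
  (Matrix.toEuclideanLin M).singularValues 1

end SKK

end

/-! ### The Jacobian of `T` and the balanced matrix. -/

namespace SKK

/-! At the fixed point, `J_T(x) D(x) = D(x) PᵀP` with `P` positive and doubly stochastic
(`jacobian_mul_diagonal`). The steps are linear apart from normalisation, so the method is a power
iteration: in the coordinates `y = w / x`, the unnormalised iterates `w` satisfy `y_{k+1} = ((PᵀP)^ℓ
+ F_k) y_k`, where `F_k` is conjugate to `E_k` and of size `O(r^k)`, `r = σ₂^{2ℓ}`.

The symmetric stochastic matrix `PᵀP` fixes constants, contracts sum-zero vectors by `σ₂²`, and `σ₂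
< 1` (`norm_gram_le_sigmaTwo`, `sigmaTwo_lt_one`). The perturbations are summable, so `y_k` stays
bounded and its sum-zero part is `O(k r^k)` (`perturbed_power_iteration`).

Assumption 2 and positivity bound the sum of `w` away from zero (`exists_sum_rawIter_ge`), so
normalising preserves this rate. The factor `k` disappears under the `k`-th root. -/

theorem hasFDerivAt_opU {n : ℕ} {y : Fin n → ℝ} (hy : ∀ i, y i ≠ 0) :
    HasFDerivAt opU
      (LinearMap.toContinuousLinearMap
        (Matrix.toLin' (Matrix.diagonal fun i => -((y i)⁻¹ ^ 2)))) y := by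
  refine hasFDerivAt_pi'' fun i => ?_
  have h := (hasDerivAt_inv (hy i)).hasFDerivAt.comp y (hasFDerivAt_apply (𝕜 := ℝ) i y)
  refine h.congr_fderiv ?_
  ext j
  simp [Matrix.mulVec_diagonal, mul_comm]

theorem mulVec_pos {m n : ℕ} {A : Matrix (Fin m) (Fin n) ℝ} (hA : ∀ i j, 0 < A i j)
    (hn : 0 < n) {y : Fin n → ℝ} (hy : ∀ i, 0 < y i) (i : Fin m) : 0 < (A *ᵥ y) i :=
  Finset.sum_pos (fun j _ => mul_pos (hA i j) (hy j)) ⟨⟨0, hn⟩, Finset.mem_univ _⟩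

theorem opU_pos {n : ℕ} {y : Fin n → ℝ} (hy : ∀ i, 0 < y i) (i : Fin n) : 0 < opU y i :=
  inv_pos.2 (hy i)

theorem opS_pos {n : ℕ} {A : Matrix (Fin n) (Fin n) ℝ} (hA : ∀ i j, 0 < A i j)
    {y : Fin n → ℝ} (hy : ∀ i, 0 < y i) (i : Fin n) : 0 < opS A y i :=
  opU_pos (fun j => mulVec_pos hA i.pos hy j) i

theorem opT_pos {n : ℕ} {A : Matrix (Fin n) (Fin n) ℝ} (hA : ∀ i j, 0 < A i j)
    {y : Fin n → ℝ} (hy : ∀ i, 0 < y i) (i : Fin n) : 0 < opT A y i :=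
  opU_pos (fun j => mulVec_pos (A := Aᵀ) (fun a b => hA b a) i.pos (opS_pos hA hy) j) i

theorem jacobian_eq {n : ℕ} {A : Matrix (Fin n) (Fin n) ℝ} (hA : ∀ i j, 0 < A i j)
    {y : Fin n → ℝ} (hy : ∀ i, 0 < y i) :
    jacobian A y = Matrix.diagonal (fun i => opT A y i ^ 2) * Aᵀ *
      Matrix.diagonal (fun i => opS A y i ^ 2) * A := by
  have hlin (B : Matrix (Fin n) (Fin n) ℝ) (z : Fin n → ℝ) :
      HasFDerivAt (fun v => B *ᵥ v) (LinearMap.toContinuousLinearMap (Matrix.toLin' B)) z :=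
    (LinearMap.toContinuousLinearMap (Matrix.toLin' B)).hasFDerivAt
  have h1 := (hasFDerivAt_opU (y := A *ᵥ y)
    (fun i => (mulVec_pos hA i.pos hy i).ne')).comp y (hlin A y)
  have h2 := (hlin Aᵀ (opU (A *ᵥ y))).comp y h1
  have h3 := (hasFDerivAt_opU (y := Aᵀ *ᵥ opU (A *ᵥ y))
    (fun i => (mulVec_pos (A := Aᵀ) (fun a b => hA b a) i.pos (opS_pos hA hy) i).ne')).comp y h2
  have h4 : HasFDerivAt (opT A) _ y := h3
  rw [jacobian, h4.fderiv]
  apply Matrix.toLin'.injective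
  rw [Matrix.toLin'_toMatrix']
  ext v i
  simp [opT, opS, opU, Matrix.mulVec_diagonal, Matrix.mulVec_single]
  simp [Matrix.mulVec, dotProduct, Finset.mul_sum]

theorem jacobian_pos {n : ℕ} {A : Matrix (Fin n) (Fin n) ℝ} (hA : ∀ i j, 0 < A i j)
    {y : Fin n → ℝ} (hy : ∀ i, 0 < y i) (i j : Fin n) : 0 < jacobian A y i j := by
  rw [jacobian_eq hA hy, Matrix.mul_apply]
  refine Finset.sum_pos (fun k _ => mul_pos ?_ (hA k j)) ⟨i, Finset.mem_univ _⟩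
  rw [Matrix.mul_diagonal, Matrix.diagonal_mul]
  exact mul_pos (mul_pos (pow_pos (opT_pos hA hy i) 2) (hA k i)) (pow_pos (opS_pos hA hy k) 2)

theorem mul_apply_pos {n : ℕ} {A B : Matrix (Fin n) (Fin n) ℝ} (hA : ∀ i j, 0 < A i j)
    (hB : ∀ i j, 0 < B i j) (i j : Fin n) : 0 < (A * B) i j := by
  rw [Matrix.mul_apply]
  exact Finset.sum_pos (fun k _ => mul_pos (hA i k) (hB k j)) ⟨i, Finset.mem_univ _⟩

theorem pow_apply_pos {n : ℕ} {A : Matrix (Fin n) (Fin n) ℝ} (hA : ∀ i j, 0 < A i j)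
    {k : ℕ} (hk : 1 ≤ k) (i j : Fin n) : 0 < (A ^ k) i j := by
  induction k, hk using Nat.le_induction generalizing i j with
  | base => simpa using hA i j
  | succ k _ ih => rw [pow_succ]; exact mul_apply_pos ih hA i j

theorem mulVec_opS_of_opT_eq {n : ℕ} {A : Matrix (Fin n) (Fin n) ℝ} {x : Fin n → ℝ}
    (hfix : opT A x = x) (i : Fin n) : (Aᵀ *ᵥ opS A x) i = (x i)⁻¹ := by
  rw [← congrFun hfix i]; simp [opT, opS, opU]

theorem balanced_pos {n : ℕ} {A : Matrix (Fin n) (Fin n) ℝ} (hA : ∀ i j, 0 < A i j)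
    {x : Fin n → ℝ} (hx : ∀ i, 0 < x i) (i j : Fin n) : 0 < balanced A x i j := by
  rw [balanced, Matrix.mul_diagonal, Matrix.diagonal_mul]
  exact mul_pos (mul_pos (opS_pos hA hx i) (hA i j)) (hx j)

theorem balanced_row_sum {n : ℕ} {A : Matrix (Fin n) (Fin n) ℝ} (hA : ∀ i j, 0 < A i j)
    {x : Fin n → ℝ} (hx : ∀ i, 0 < x i) (i : Fin n) : ∑ j, balanced A x i j = 1 := by
  simp only [balanced, Matrix.mul_diagonal, Matrix.diagonal_mul, mul_assoc]
  rw [← Finset.mul_sum]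
  exact inv_mul_cancel₀ (mulVec_pos hA i.pos hx i).ne'

theorem balanced_col_sum {n : ℕ} {A : Matrix (Fin n) (Fin n) ℝ}
    {x : Fin n → ℝ} (hx : ∀ i, 0 < x i) (hfix : opT A x = x) (j : Fin n) :
    ∑ i, balanced A x i j = 1 := by
  have h := mulVec_opS_of_opT_eq hfix j
  simp only [balanced, Matrix.mul_diagonal, Matrix.diagonal_mul]
  rw [← Finset.sum_mul]
  simp only [Matrix.mulVec, dotProduct, Matrix.transpose_apply] at h
  simp only [mul_comm (opS A x _)]
  rw [h, inv_mul_cancel₀ (hx j).ne']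

/-- With `Tx = x`, the left factor of the Jacobian is `D(x)²`; one `D(x)` goes to each side and
`D(Sx)²` is split between `Pᵀ` and `P`. -/
theorem jacobian_mul_diagonal {n : ℕ} {A : Matrix (Fin n) (Fin n) ℝ} (hA : ∀ i j, 0 < A i j)
    {x : Fin n → ℝ} (hx : ∀ i, 0 < x i) (hfix : opT A x = x) :
    jacobian A x * Matrix.diagonal x =
      Matrix.diagonal x * ((balanced A x)ᵀ * balanced A x) := by
  rw [jacobian_eq hA hx, hfix, balanced]
  simp only [Matrix.transpose_mul, Matrix.diagonal_transpose, pow_two,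
    ← Matrix.diagonal_mul_diagonal, Matrix.mul_assoc]

end SKK

/-! ### The spectral gap of `PᵀP`. -/

namespace SKK

/-- The Dirichlet form of `G`: for an eigenvalue at least one the right side is nonpositive, so
every term on the left vanishes. -/
theorem sum_mul_sub_sq {n : ℕ} {G : Matrix (Fin n) (Fin n) ℝ} (hG : G.IsSymm)
    (hrow : ∀ i, ∑ j, G i j = 1) (v : Fin n → ℝ) :
    ∑ i, ∑ j, G i j * (v i - v j) ^ 2 = 2 * (v ⬝ᵥ v - v ⬝ᵥ G *ᵥ v) := by
  have h1 : ∑ i, ∑ j, G i j * v i ^ 2 = v ⬝ᵥ v := by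
    simp only [← Finset.sum_mul, hrow, dotProduct]
    simp [pow_two]
  have h2 : ∑ i, ∑ j, G i j * v j ^ 2 = v ⬝ᵥ v := by
    rw [Finset.sum_comm, ← h1]
    exact Finset.sum_congr rfl fun i _ => Finset.sum_congr rfl fun j _ => by rw [hG.apply]
  have h3 : ∑ i, ∑ j, v i * (G i j * v j) = v ⬝ᵥ G *ᵥ v := by
    simp only [dotProduct, Matrix.mulVec, Finset.mul_sum]
  calc ∑ i, ∑ j, G i j * (v i - v j) ^ 2
      = ∑ i, ∑ j, G i j * v i ^ 2 + ∑ i, ∑ j, G i j * v j ^ 2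
          - 2 * ∑ i, ∑ j, v i * (G i j * v j) := by
        simp only [Finset.mul_sum, ← Finset.sum_add_distrib, ← Finset.sum_sub_distrib]
        exact Finset.sum_congr rfl fun i _ => Finset.sum_congr rfl fun j _ => by ring
    _ = _ := by rw [h1, h2, h3]; ring

/-- Perron–Frobenius for symmetric stochastic matrices: an eigenvector for an eigenvalue which is
at least one is constant. -/
theorem eq_of_mulVec_eq_smul {n : ℕ} {G : Matrix (Fin n) (Fin n) ℝ} (hG : G.IsSymm)
    (hpos : ∀ i j, 0 < G i j) (hrow : ∀ i, ∑ j, G i j = 1) {v : Fin n → ℝ} {c : ℝ} (hc : 1 ≤ c)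
    (hv : G *ᵥ v = c • v) (i j : Fin n) : v i = v j := by
  have hn (i j : Fin n) : 0 ≤ G i j * (v i - v j) ^ 2 := mul_nonneg (hpos i j).le (sq_nonneg _)
  have hle : ∑ i, ∑ j, G i j * (v i - v j) ^ 2 ≤ 0 := by
    rw [sum_mul_sub_sq hG hrow, hv, dotProduct_smul, smul_eq_mul]
    have : 0 ≤ v ⬝ᵥ v := Finset.sum_nonneg fun i _ => mul_self_nonneg _
    nlinarith
  have h0 := hle.antisymm (Finset.sum_nonneg fun i _ => Finset.sum_nonneg fun j _ => hn i j)
  rw [Finset.sum_eq_zero_iff_of_nonneg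
    fun i _ => Finset.sum_nonneg fun j _ => hn i j] at h0
  have h1 := (Finset.sum_eq_zero_iff_of_nonneg fun j _ => hn i j).1 (h0 i (Finset.mem_univ _)) j
    (Finset.mem_univ _)
  have h2 := (mul_eq_zero.1 h1).resolve_left (hpos i j).ne'
  exact sub_eq_zero.1 (pow_eq_zero_iff two_ne_zero |>.1 h2)

section Gap

variable {n : ℕ} {P : Matrix (Fin n) (Fin n) ℝ} (hpos : ∀ i j, 0 < P i j)
  (hrow : ∀ i, ∑ j, P i j = 1) (hcol : ∀ j, ∑ i, P i j = 1)

theorem adjoint_comp_toEuclideanLin (P : Matrix (Fin n) (Fin n) ℝ) :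
    (Matrix.toEuclideanLin P).adjoint ∘ₗ Matrix.toEuclideanLin P =
      Matrix.toEuclideanLin (Pᵀ * P) := by
  rw [← Matrix.toEuclideanLin_conjTranspose_eq_adjoint, Matrix.conjTranspose_eq_transpose_of_trivial]
  ext v i
  simp [Matrix.mulVec_mulVec]

include hrow hcol in
theorem transpose_mul_self_row_sum (i : Fin n) : ∑ j, (Pᵀ * P) i j = 1 := by
  simp only [Matrix.mul_apply]
  rw [Finset.sum_comm]
  simp [← Finset.mul_sum, hrow, hcol]

theorem isSymm_transpose_mul_self (P : Matrix (Fin n) (Fin n) ℝ) : (Pᵀ * P).IsSymm := by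
  simp [Matrix.IsSymm, Matrix.transpose_mul]

include hpos hrow hcol in
theorem eigenvector_const {v : EuclideanSpace ℝ (Fin n)} {c : ℝ} (hc : 1 ≤ c)
    (hv : ((Matrix.toEuclideanLin P).adjoint ∘ₗ Matrix.toEuclideanLin P) v = c • v)
    (i j : Fin n) : v i = v j := by
  rw [adjoint_comp_toEuclideanLin] at hv
  refine eq_of_mulVec_eq_smul (isSymm_transpose_mul_self P) (fun i j => ?_)
    (transpose_mul_self_row_sum hrow hcol) hc (congrArg WithLp.ofLp hv) i j
  rw [Matrix.mul_apply]
  exact Finset.sum_pos (fun k _ => mul_pos (hpos k i) (hpos k j)) ⟨i, Finset.mem_univ _⟩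

theorem isSymmetric_gram (P : Matrix (Fin n) (Fin n) ℝ) :
    ((Matrix.toEuclideanLin P).adjoint ∘ₗ Matrix.toEuclideanLin P).IsSymmetric :=
  (Matrix.toEuclideanLin P).isSymmetric_adjoint_comp_self

/-- The eigenvalues of `Pᵀ P`, in decreasing order. -/
noncomputable abbrev gramEigenvalues (P : Matrix (Fin n) (Fin n) ℝ) : Fin n → ℝ :=
  (isSymmetric_gram P).eigenvalues finrank_euclideanSpace_fin

/-- An orthonormal basis of eigenvectors of `Pᵀ P`. -/
noncomputable abbrev gramBasis (P : Matrix (Fin n) (Fin n) ℝ) :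
    OrthonormalBasis (Fin n) ℝ (EuclideanSpace ℝ (Fin n)) :=
  (isSymmetric_gram P).eigenvectorBasis finrank_euclideanSpace_fin

theorem toEuclideanLin_gramBasis (P : Matrix (Fin n) (Fin n) ℝ) (k : Fin n) :
    Matrix.toEuclideanLin (Pᵀ * P) (gramBasis P k) = gramEigenvalues P k • gramBasis P k :=
  (DFunLike.congr_fun (adjoint_comp_toEuclideanLin P) _).symm.trans
    ((isSymmetric_gram P).apply_eigenvectorBasis finrank_euclideanSpace_fin k)

theorem sq_singularValues_eq_gramEigenvalues (P : Matrix (Fin n) (Fin n) ℝ) (k : Fin n) :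
    (Matrix.toEuclideanLin P).singularValues k ^ 2 = gramEigenvalues P k :=
  (Matrix.toEuclideanLin P).sq_singularValues_fin finrank_euclideanSpace_fin k

include hpos hrow hcol in
theorem gramBasis_const {k : Fin n} (hk : 1 ≤ gramEigenvalues P k) (i j : Fin n) :
    gramBasis P k i = gramBasis P k j :=
  eigenvector_const hpos hrow hcol hk
    (LinearMap.IsSymmetric.apply_eigenvectorBasis (isSymmetric_gram P) finrank_euclideanSpace_fin k) i j

include hrow hcol in
theorem gram_mulVec_const (c : ℝ) : (Pᵀ * P) *ᵥ (fun _ => c) = fun _ => c := by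
  ext i
  simp [Matrix.mulVec, dotProduct, ← Finset.sum_mul, transpose_mul_self_row_sum hrow hcol]

include hpos hrow hcol in
-- An eigenvector for a larger eigenvalue would be constant, but constants are fixed.
theorem gramEigenvalues_le_one (k : Fin n) : gramEigenvalues P k ≤ 1 := by
  by_contra! h
  have hconst := gramBasis_const hpos hrow hcol h.le
  have hv := toEuclideanLin_gramBasis P k
  have h1 := congrArg WithLp.ofLp hv
  have h2 : WithLp.ofLp (gramBasis P k) = fun _ => gramBasis P k k := funext fun i => hconst i k
  rw [Matrix.ofLp_toLpLin, Matrix.toLin'_apply, h2, gram_mulVec_const hrow hcol, WithLp.ofLp_smul, h2] at h1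
  have h3 := congrFun h1 k
  simp only [Pi.smul_apply, smul_eq_mul] at h3
  have h4 : gramBasis P k k = 0 := by
    by_contra h0
    exact h.ne (mul_right_cancel₀ h0 (by linarith))
  have h5 : gramBasis P k = 0 := by
    ext i
    rw [hconst i k, h4]; rfl
  have h6 := (gramBasis P).orthonormal.1 k
  rw [h5] at h6
  simp at h6

include hpos hrow hcol in
-- Otherwise the top two eigenvalues of `PᵀP` are at least one and both have constant eigenvectors,
-- which cannot be orthonormal.
theorem sigmaTwo_lt_one : sigmaTwo P < 1 := by
  unfold sigmaTwo
  rcases lt_or_ge 1 n with hn | hn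
  · by_contra! h
    have h1 : 1 ≤ gramEigenvalues P ⟨1, hn⟩ := by
      rw [← sq_singularValues_eq_gramEigenvalues]
      exact one_le_pow₀ h
    have h0 : 1 ≤ gramEigenvalues P ⟨0, by omega⟩ :=
      h1.trans (LinearMap.IsSymmetric.eigenvalues_antitone (isSymmetric_gram P) _ (by simp))
    have c0 := gramBasis_const hpos hrow hcol h0
    have c1 := gramBasis_const hpos hrow hcol h1
    set a := gramBasis P ⟨0, by omega⟩ with ha
    set b := gramBasis P ⟨1, hn⟩ with hb
    let z : Fin n := ⟨0, by omega⟩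
    have hab : inner ℝ a b = 0 := (gramBasis P).orthonormal.2 (by simp)
    have haa : inner ℝ a a = 1 := by
      rw [real_inner_self_eq_norm_sq, ha, (gramBasis P).orthonormal.1]; simp
    have hbb : inner ℝ b b = 1 := by
      rw [real_inner_self_eq_norm_sq, hb, (gramBasis P).orthonormal.1]; simp
    simp only [PiLp.inner_apply, c0 _ z, c1 _ z] at hab haa hbb
    simp at hab haa hbb
    rcases hab with h | h | h
    · omega
    · simp [h] at hbb
    · simp [h] at haa
  · rw [LinearMap.singularValues_of_finrank_le _ (by simpa using hn)]
    exact one_pos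

theorem inner_gramBasis_gram (v : EuclideanSpace ℝ (Fin n)) (k : Fin n) :
    inner ℝ (gramBasis P k) (Matrix.toEuclideanLin (Pᵀ * P) v) = gramEigenvalues P k * inner ℝ (gramBasis P k) v := by
  rw [← adjoint_comp_toEuclideanLin, ← isSymmetric_gram P (gramBasis P k) v,
    LinearMap.IsSymmetric.apply_eigenvectorBasis, real_inner_smul_left]
  simp

/-- Parseval in the eigenbasis; the eigenvalues are nonnegative, so an upper bound suffices. -/
theorem norm_gram_le_of_forall {c : ℝ} (hc : 0 ≤ c) (v : EuclideanSpace ℝ (Fin n))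
    (h : ∀ k, gramEigenvalues P k ≤ c ∨ inner ℝ (gramBasis P k) v = 0) :
    ‖Matrix.toEuclideanLin (Pᵀ * P) v‖ ≤ c * ‖v‖ := by
  refine abs_le_of_sq_le_sq' ?_ (by positivity) |>.2
  rw [mul_pow, ← (gramBasis P).sum_sq_norm_inner_right, ← (gramBasis P).sum_sq_norm_inner_right v, Finset.mul_sum]
  refine Finset.sum_le_sum fun k _ => ?_
  rw [inner_gramBasis_gram, norm_mul, mul_pow]
  rcases h k with h | h
  · gcongr
    rw [Real.norm_of_nonneg
      ((Matrix.toEuclideanLin P).isPositive_adjoint_comp_self.nonneg_eigenvalues _ k)]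
    exact h
  · simp [h]

include hpos hrow hcol in
theorem norm_gram_le (v : EuclideanSpace ℝ (Fin n)) :
    ‖Matrix.toEuclideanLin (Pᵀ * P) v‖ ≤ ‖v‖ := by
  simpa using norm_gram_le_of_forall zero_le_one v
    fun k => Or.inl (gramEigenvalues_le_one hpos hrow hcol k)

include hpos hrow hcol in
-- Sum-zero vectors are orthogonal to the constant eigenvectors, hence to all those with eigenvalue
-- one; every other eigenvalue is at most the second.
theorem norm_gram_le_sigmaTwo {v : EuclideanSpace ℝ (Fin n)} (hv : ∑ i, v i = 0) :
    ‖Matrix.toEuclideanLin (Pᵀ * P) v‖ ≤ sigmaTwo P ^ 2 * ‖v‖ := by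
  refine norm_gram_le_of_forall (sq_nonneg _) v fun k => ?_
  have hconst (k : Fin n) (hk : 1 ≤ gramEigenvalues P k) : inner ℝ (gramBasis P k) v = 0 := by
    have c := gramBasis_const hpos hrow hcol hk
    simp only [PiLp.inner_apply, c _ k]
    simp [← Finset.sum_mul, hv]
  by_cases hk1 : 1 ≤ gramEigenvalues P k
  · exact Or.inr (hconst k hk1)
  left
  -- If the largest eigenvalue were below one, the fixed vector `e` would be orthogonal to the whole
  -- basis.
  have hk0 : 0 < (k : ℕ) := by
    by_contra! h0
    let e : EuclideanSpace ℝ (Fin n) := WithLp.toLp 2 fun _ => 1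
    have he : Matrix.toEuclideanLin (Pᵀ * P) e = e := by
      rw [Matrix.toLpLin_toLp, Matrix.toLin'_apply, gram_mulVec_const hrow hcol]
    have hall (m : Fin n) : inner ℝ (gramBasis P m) e = 0 := by
      have h1 := inner_gramBasis_gram (P := P) e m
      rw [he] at h1
      have h2 : gramEigenvalues P m ≤ gramEigenvalues P k :=
        LinearMap.IsSymmetric.eigenvalues_antitone (isSymmetric_gram P) _ (Fin.le_def.2 (by omega))
      by_contra hne
      exact (h2.trans_lt (not_le.1 hk1)).ne (mul_right_cancel₀ hne (by linarith))
    have h3 : e = 0 := by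
      rw [← (gramBasis P).sum_repr' e]
      simp [hall]
    have h4 := congrArg (fun u : EuclideanSpace ℝ (Fin n) => u k) h3
    simp [e] at h4
  have hn : 1 < n := by omega
  rw [sigmaTwo]
  rw [show (Matrix.toEuclideanLin P).singularValues 1 ^ 2 = gramEigenvalues P ⟨1, hn⟩ from
    sq_singularValues_eq_gramEigenvalues P ⟨1, hn⟩]
  exact LinearMap.IsSymmetric.eigenvalues_antitone (isSymmetric_gram P) _ (Fin.le_def.2 hk0)

include hrow hcol in
theorem sum_gram (v : EuclideanSpace ℝ (Fin n)) :
    ∑ i, Matrix.toEuclideanLin (Pᵀ * P) v i = ∑ i, v i := by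
  simp only [Matrix.ofLp_toLpLin, Matrix.toLin'_apply, Matrix.mulVec, dotProduct]
  rw [Finset.sum_comm]
  simp only [← Finset.sum_mul, ← (isSymm_transpose_mul_self P).apply _ _]
  simp only [transpose_mul_self_row_sum hrow hcol, one_mul]

theorem toEuclideanLin_pow_succ (G : Matrix (Fin n) (Fin n) ℝ) (k : ℕ)
    (v : EuclideanSpace ℝ (Fin n)) :
    Matrix.toEuclideanLin (G ^ (k + 1)) v =
      Matrix.toEuclideanLin G (Matrix.toEuclideanLin (G ^ k) v) := by
  ext i
  simp [pow_succ']

include hpos hrow hcol in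
theorem norm_gram_pow_le (k : ℕ) (v : EuclideanSpace ℝ (Fin n)) :
    ‖Matrix.toEuclideanLin ((Pᵀ * P) ^ k) v‖ ≤ ‖v‖ := by
  induction k with
  | zero => simp
  | succ k ih =>
    rw [toEuclideanLin_pow_succ]
    exact (norm_gram_le hpos hrow hcol _).trans ih

include hpos hrow hcol in
theorem norm_gram_pow_le_sigmaTwo (k : ℕ) {v : EuclideanSpace ℝ (Fin n)} (hv : ∑ i, v i = 0) :
    ‖Matrix.toEuclideanLin ((Pᵀ * P) ^ k) v‖ ≤ sigmaTwo P ^ (2 * k) * ‖v‖ := by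
  have hsum (k : ℕ) : ∑ i, Matrix.toEuclideanLin ((Pᵀ * P) ^ k) v i = 0 := by
    induction k with
    | zero => simpa using hv
    | succ k ih => rw [toEuclideanLin_pow_succ, sum_gram hrow hcol, ih]
  induction k with
  | zero => simp
  | succ k ih =>
    rw [toEuclideanLin_pow_succ]
    calc _ ≤ sigmaTwo P ^ 2 * _ := norm_gram_le_sigmaTwo hpos hrow hcol (hsum k)
      _ ≤ sigmaTwo P ^ 2 * (sigmaTwo P ^ (2 * k) * ‖v‖) := by gcongr
      _ = _ := by ring

include hrow hcol in
theorem gram_pow_const (k : ℕ) (c : ℝ) :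
    Matrix.toEuclideanLin ((Pᵀ * P) ^ k) (WithLp.toLp 2 fun _ => c) = WithLp.toLp 2 fun _ => c := by
  induction k with
  | zero => simp
  | succ k ih =>
    rw [toEuclideanLin_pow_succ, ih, Matrix.toLpLin_toLp, Matrix.toLin'_apply,
      gram_mulVec_const hrow hcol]

end Gap

end SKK

/-! ### Perturbed power iteration and root asymptotics. -/

namespace SKK

/-- The product of the factors `1 + η r^i` is at most `exp (η ∑ r^i)`. -/
theorem bounded_of_le_one_add_geometric {a : ℕ → ℝ} {η r : ℝ} (ha : ∀ k, 0 ≤ a k) (hη : 0 ≤ η)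
    (hr : 0 ≤ r) (hr1 : r < 1) (h : ∀ k, a (k + 1) ≤ (1 + η * r ^ k) * a k) :
    ∃ B, 0 ≤ B ∧ ∀ k, a k ≤ B := by
  have key (k : ℕ) : a k ≤ Real.exp (η * ∑ i ∈ Finset.range k, r ^ i) * a 0 := by
    induction k with
    | zero => simp
    | succ k ih =>
      calc a (k + 1) ≤ (1 + η * r ^ k) * a k := h k
        _ ≤ Real.exp (η * r ^ k) * (Real.exp (η * ∑ i ∈ Finset.range k, r ^ i) * a 0) := by
          have := Real.add_one_le_exp (η * r ^ k)
          gcongr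
          · exact ha k
          · linarith
        _ = _ := by rw [← mul_assoc, ← Real.exp_add, Finset.sum_range_succ]; ring_nf
  refine ⟨Real.exp (η * (1 - r)⁻¹) * a 0, mul_nonneg (Real.exp_pos _).le (ha 0), fun k => ?_⟩
  refine (key k).trans ?_
  have hs : ∑ i ∈ Finset.range k, r ^ i ≤ (1 - r)⁻¹ := by
    rw [← tsum_geometric_of_lt_one hr hr1]
    exact (summable_geometric_of_lt_one hr hr1).sum_le_tsum _ fun i _ => pow_nonneg hr i
  have := ha 0
  gcongr

/-- Power iteration with geometrically decaying perturbations: the component killed by the dominant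
direction decays at the rate of the subdominant eigenvalue, up to a linear factor. -/
theorem perturbed_power_iteration {E : Type*} [NormedAddCommGroup E] [NormedSpace ℝ E]
    {Q R : E → E} (hRadd : ∀ u v, R (u + v) = R u + R v) {η r : ℝ} (hη : 0 ≤ η) (hr : 0 ≤ r)
    (hr1 : r < 1) (hQ : ∀ v, ‖Q v‖ ≤ ‖v‖) (hR : ∀ v, ‖R v‖ ≤ ‖v‖)
    (hRQ : ∀ v, ‖R (Q v)‖ ≤ r * ‖R v‖) {y f : ℕ → E} (hy : ∀ k, y (k + 1) = Q (y k) + f k)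
    (hf : ∀ k, ‖f k‖ ≤ η * r ^ k * ‖y k‖) :
    ∃ C, 0 ≤ C ∧ ∀ k : ℕ, ‖R (y (k + 1))‖ ≤ C * ((k + 1) * r ^ k) := by
  obtain ⟨B, hB, hyB⟩ := bounded_of_le_one_add_geometric (a := fun k => ‖y k‖)
    (fun k => norm_nonneg _) hη hr hr1 (fun k => by
      rw [hy]
      calc _ ≤ ‖Q (y k)‖ + ‖f k‖ := norm_add_le _ _
        _ ≤ ‖y k‖ + η * r ^ k * ‖y k‖ := add_le_add (hQ _) (hf k)
        _ = _ := by ring)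
  have step (k : ℕ) : ‖R (y (k + 1))‖ ≤ r * ‖R (y k)‖ + η * r ^ k * B := by
    rw [hy, hRadd]
    refine (norm_add_le _ _).trans (add_le_add (hRQ _) ((hR _).trans ((hf k).trans ?_)))
    have := hyB k
    gcongr
  -- `B` covers the initial value and `η * B` the perturbation added at each step.
  refine ⟨(1 + η) * B, by positivity, fun k => ?_⟩
  induction k with
  | zero =>
    refine (step 0).trans ?_
    have h1 : ‖R (y 0)‖ ≤ B := (hR _).trans (hyB 0)
    have h2 : r * ‖R (y 0)‖ ≤ 1 * B := by gcongr
    simp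
    linarith
  | succ k ih =>
    calc _ ≤ r * ‖R (y (k + 1))‖ + η * r ^ (k + 1) * B := step _
      _ ≤ r * ((1 + η) * B * ((k + 1) * r ^ k)) + (1 + η) * r ^ (k + 1) * B := by
        gcongr
        linarith
      _ = _ := by push_cast; ring

theorem tendsto_zero_of_le_linear_mul_geometric {a : ℕ → ℝ} {C r : ℝ} (ha : ∀ k, 0 ≤ a k)
    (hr : 0 ≤ r) (hr1 : r < 1) (h : ∀ k : ℕ, a (k + 1) ≤ C * ((k + 1) * r ^ k)) :
    Tendsto a atTop (𝓝 0) := by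
  rw [← tendsto_add_atTop_iff_nat 1]
  have h1 : Tendsto (fun k : ℕ => C * ((k + 1 : ℝ) * r ^ k)) atTop (𝓝 0) := by
    have := ((tendsto_self_mul_const_pow_of_lt_one hr hr1).add
      (tendsto_pow_atTop_nhds_zero_of_lt_one hr hr1)).const_mul C
    simpa [add_mul] using this
  exact squeeze_zero (fun k => ha _) h h1

theorem limsup_root_le_of_le_linear_mul_geometric {a : ℕ → ℝ} {C r : ℝ} (ha : ∀ k, 0 ≤ a k)
    (hr : 0 ≤ r) (h : ∀ k : ℕ, a (k + 1) ≤ C * ((k + 1) * r ^ k)) :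
    limsup (fun k : ℕ => ((a k ^ (1 / (k : ℝ)) : ℝ) : EReal)) atTop ≤ ((r : ℝ) : EReal) := by
  -- For `r = 0` the bound still allows `a 1 ≠ 0`, as `0 ^ 0 = 1`, but forces `a k = 0` from `k = 2`
  -- on.
  rcases hr.eq_or_lt with rfl | hr0
  · refine limsup_le_of_le (h := ?_)
    filter_upwards [eventually_ge_atTop 2] with k hk
    obtain ⟨m, rfl⟩ : ∃ m, k = m + 1 + 1 := ⟨k - 2, by omega⟩
    have h0 : a (m + 1 + 1) = 0 := le_antisymm (by simpa using h (m + 1)) (ha _)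
    rw [h0, Real.zero_rpow (by positivity)]
  -- Dividing by `r` absorbs the index shift; `|C| + 1` makes `D` positive, so `D^{1/k}` tends to
  -- one.
  · let D : ℝ := (|C| + 1) / r
    have hD : 0 < D := by positivity
    have hlim : Tendsto (fun k : ℕ => D ^ (1 / (k : ℝ)) * (k : ℝ) ^ (1 / (k : ℝ)) * r) atTop
        (𝓝 r) := by
      have h1 : Tendsto (fun k : ℕ => D ^ (1 / (k : ℝ))) atTop (𝓝 1) := by
        have := (Real.continuousAt_const_rpow hD.ne' (b := 0)).tendsto.comp
          (tendsto_one_div_atTop_nhds_zero_nat (𝕜 := ℝ))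
        simpa [Function.comp_def] using this
      have h2 := tendsto_rpow_div.comp (tendsto_natCast_atTop_atTop (R := ℝ))
      simpa [Function.comp_def] using (h1.mul h2).mul_const r
    have hlimE := (continuous_coe_real_ereal.tendsto r).comp hlim
    rw [← hlimE.limsup_eq]
    refine limsup_le_limsup ?_
    filter_upwards [eventually_ge_atTop 1] with k hk
    obtain ⟨m, rfl⟩ : ∃ m, k = m + 1 := ⟨k - 1, by omega⟩
    simp only [Function.comp, EReal.coe_le_coe_iff]
    have hb : a (m + 1) ≤ D * ((m + 1 : ℕ) : ℝ) * r ^ (m + 1) := by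
      calc _ ≤ C * ((m + 1) * r ^ m) := h m
        _ ≤ (|C| + 1) * ((m + 1) * r ^ m) := by gcongr; linarith [le_abs_self C]
        _ = _ := by simp only [D]; push_cast; field_simp; ring
    calc a (m + 1) ^ (1 / ((m + 1 : ℕ) : ℝ))
        ≤ (D * ((m + 1 : ℕ) : ℝ) * r ^ (m + 1)) ^ (1 / ((m + 1 : ℕ) : ℝ)) :=
          Real.rpow_le_rpow (ha _) hb (by positivity)
      _ = _ := by
        rw [Real.mul_rpow (by positivity) (by positivity),
          Real.mul_rpow hD.le (by positivity), one_div,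
          Real.pow_rpow_inv_natCast hr (by omega)]

end SKK

/-! ### Unnormalised iterates and the error estimate. -/

namespace SKK

/-- The iterates of SKK_ℓ without the normalisation steps. -/
noncomputable def rawIter {n : ℕ} (A : Matrix (Fin n) (Fin n) ℝ) (ℓ : ℕ) (x₀ : Fin n → ℝ) :
    ℕ → (Fin n → ℝ)
  | 0 => x₀
  | k + 1 => (jacobian A (iter A ℓ x₀ k)) ^ ℓ *ᵥ rawIter A ℓ x₀ k

theorem iter_succ {n : ℕ} (A : Matrix (Fin n) (Fin n) ℝ) (ℓ : ℕ) (x₀ : Fin n → ℝ) (k : ℕ) :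
    iter A ℓ x₀ (k + 1) = (∑ i, ((jacobian A (iter A ℓ x₀ k)) ^ ℓ *ᵥ iter A ℓ x₀ k) i)⁻¹ •
      ((jacobian A (iter A ℓ x₀ k)) ^ ℓ *ᵥ iter A ℓ x₀ k) := rfl

section

variable {n : ℕ} {A : Matrix (Fin n) (Fin n) ℝ} (hA : ∀ i j, 0 < A i j) {ℓ : ℕ} (hℓ : 1 ≤ ℓ)
  {x₀ : Fin n → ℝ} (hx₀ : ∀ i, 0 < x₀ i)

include hA hℓ hx₀

theorem iter_pos (k : ℕ) (i : Fin n) : 0 < iter A ℓ x₀ k i := by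
  induction k generalizing i with
  | zero => exact hx₀ i
  | succ k ih =>
    have hv := mulVec_pos (pow_apply_pos (jacobian_pos hA ih) hℓ) i.pos ih
    rw [iter_succ]
    exact mul_pos (inv_pos.2 (Finset.sum_pos (fun j _ => hv j) ⟨i, Finset.mem_univ _⟩)) (hv i)

theorem jacobian_iter_pow_pos (k : ℕ) (i j : Fin n) :
    0 < ((jacobian A (iter A ℓ x₀ k)) ^ ℓ) i j :=
  pow_apply_pos (jacobian_pos hA (iter_pos hA hℓ hx₀ k)) hℓ i j

theorem rawIter_pos (k : ℕ) (i : Fin n) : 0 < rawIter A ℓ x₀ k i := by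
  induction k generalizing i with
  | zero => exact hx₀ i
  | succ k ih => exact mulVec_pos (jacobian_iter_pow_pos hA hℓ hx₀ k) i.pos ih i

theorem jacProd_pos (m : ℕ) (i j : Fin n) : 0 < jacProd A ℓ x₀ m i j := by
  induction m generalizing i j with
  | zero => exact jacobian_iter_pow_pos hA hℓ hx₀ 0 i j
  | succ m ih => exact mul_apply_pos (jacobian_iter_pow_pos hA hℓ hx₀ (m + 1)) ih i j

theorem exists_iter_eq_smul_rawIter (k : ℕ) : ∃ c : ℝ, c ≠ 0 ∧
    iter A ℓ x₀ k = c • rawIter A ℓ x₀ k := by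
  rcases isEmpty_or_nonempty (Fin n) with h | ⟨⟨i⟩⟩
  · exact ⟨1, one_ne_zero, Subsingleton.elim _ _⟩
  induction k with
  | zero => exact ⟨1, one_ne_zero, (one_smul _ _).symm⟩
  | succ k ih =>
    obtain ⟨c, hc, h⟩ := ih
    have hv := mulVec_pos (jacobian_iter_pow_pos hA hℓ hx₀ k) i.pos (iter_pos hA hℓ hx₀ k)
    refine ⟨_, mul_ne_zero (inv_ne_zero
      (Finset.sum_pos (fun j _ => hv j) ⟨i, Finset.mem_univ _⟩).ne') hc, ?_⟩
    rw [iter_succ, mul_smul]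
    congr 1
    rw [rawIter, ← Matrix.mulVec_smul, ← h]

theorem iter_succ_eq_inv_sum_smul_rawIter (k : ℕ) :
    iter A ℓ x₀ (k + 1) = (∑ i, rawIter A ℓ x₀ (k + 1) i)⁻¹ • rawIter A ℓ x₀ (k + 1) := by
  obtain ⟨c, hc, h⟩ := exists_iter_eq_smul_rawIter hA hℓ hx₀ k
  have h1 : (jacobian A (iter A ℓ x₀ k)) ^ ℓ *ᵥ iter A ℓ x₀ k = c • rawIter A ℓ x₀ (k + 1) := by
    rw [rawIter, ← Matrix.mulVec_smul, ← h]
  rw [iter_succ, h1]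
  simp only [Pi.smul_apply, smul_eq_mul, ← Finset.mul_sum]
  rw [smul_smul, mul_inv, mul_right_comm, inv_mul_cancel₀ hc, one_mul]

end

theorem rawIter_succ_eq_jacProd_mulVec {n : ℕ} (A : Matrix (Fin n) (Fin n) ℝ) (ℓ : ℕ)
    (x₀ : Fin n → ℝ) (m : ℕ) : rawIter A ℓ x₀ (m + 1) = jacProd A ℓ x₀ m *ᵥ x₀ := by
  induction m with
  | zero => rfl
  | succ m ih => rw [rawIter, ih, jacProd, Matrix.mulVec_mulVec]

/-- The spectral norm of a nonnegative matrix is controlled by its value at a positive vector. -/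
theorem mul_norm_le_norm_mulVec {n : ℕ} {M : Matrix (Fin n) (Fin n) ℝ} (hM : ∀ i j, 0 ≤ M i j)
    {x : Fin n → ℝ} {δ : ℝ} (hδ : 0 < δ) (hx : ∀ i, δ ≤ x i) :
    δ * ‖M‖ ≤ ‖WithLp.toLp 2 (M *ᵥ x)‖ := by
  suffices h : ‖M‖ ≤ δ⁻¹ * ‖WithLp.toLp 2 (M *ᵥ x)‖ by
    rwa [inv_mul_eq_div, le_div_iff₀' hδ] at h
  rw [Matrix.l2_opNorm_def]
  refine ContinuousLinearMap.opNorm_le_bound _ (by positivity) fun v => ?_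
  -- Each `|v j|` is at most `‖v‖ δ⁻¹ x j`, and nonnegativity of `M` preserves this domination.
  have hcoord (i : Fin n) :
      ‖(M *ᵥ v.ofLp) i‖ ≤ ‖((δ⁻¹ * ‖v‖) • WithLp.toLp 2 (M *ᵥ x) : EuclideanSpace ℝ (Fin n)) i‖ := by
    have hnn : 0 ≤ (M *ᵥ x) i := by
      rw [Matrix.mulVec, dotProduct]
      exact Finset.sum_nonneg fun j _ => mul_nonneg (hM i j) (hδ.le.trans (hx j))
    rw [PiLp.smul_apply, smul_eq_mul,
      Real.norm_of_nonneg (mul_nonneg (by positivity) hnn)]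
    simp only [Matrix.mulVec, dotProduct, Finset.mul_sum]
    refine (norm_sum_le _ _).trans (Finset.sum_le_sum fun j _ => ?_)
    rw [norm_mul, Real.norm_of_nonneg (hM i j)]
    have h1 : ‖v j‖ ≤ ‖v‖ := PiLp.norm_apply_le v j
    have h2 : 1 ≤ δ⁻¹ * x j := by
      rw [inv_mul_eq_div, one_le_div hδ]; exact hx j
    calc M i j * ‖v j‖ ≤ M i j * (‖v‖ * (δ⁻¹ * x j)) := by
          have := hM i j
          gcongr
          nlinarith [norm_nonneg v]
      _ = _ := by ring
  calc ‖WithLp.toLp 2 (M *ᵥ v.ofLp)‖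
      ≤ ‖((δ⁻¹ * ‖v‖) • WithLp.toLp 2 (M *ᵥ x) : EuclideanSpace ℝ (Fin n))‖ := by
        rw [EuclideanSpace.norm_eq, EuclideanSpace.norm_eq]
        gcongr with i
        exact hcoord i
    _ = _ := by
      rw [norm_smul, Real.norm_of_nonneg (by positivity)]; ring

theorem norm_toLp_le_sum {n : ℕ} {w : Fin n → ℝ} (hw : ∀ i, 0 ≤ w i) :
    ‖WithLp.toLp 2 w‖ ≤ ∑ i, w i := by
  refine abs_le_of_sq_le_sq' ?_ (Finset.sum_nonneg fun i _ => hw i) |>.2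
  rw [EuclideanSpace.norm_sq_eq]
  simp only [Real.norm_eq_abs, sq_abs]
  exact Finset.sum_sq_le_sq_sum_of_nonneg fun i _ => hw i

theorem exists_sum_rawIter_ge {n : ℕ} {A : Matrix (Fin n) (Fin n) ℝ} (hA : ∀ i j, 0 < A i j)
    {ℓ : ℕ} (hℓ : 1 ≤ ℓ) {x₀ : Fin n → ℝ} (hx₀ : ∀ i, 0 < x₀ i)
    (hprod : ∃ γ : ℝ, 0 < γ ∧ ∀ m : ℕ, γ ≤ ‖jacProd A ℓ x₀ m‖) :
    ∃ c : ℝ, 0 < c ∧ ∀ m, c ≤ ∑ i, rawIter A ℓ x₀ (m + 1) i := by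
  obtain ⟨γ, hγ, h⟩ := hprod
  obtain ⟨δ, hδ, hle⟩ : ∃ δ : ℝ, 0 < δ ∧ ∀ i, δ ≤ x₀ i := by
    rcases isEmpty_or_nonempty (Fin n) with he | he
    · exact ⟨1, one_pos, fun i => he.elim i⟩
    · obtain ⟨i, hi⟩ := Finite.exists_min x₀
      exact ⟨x₀ i, hx₀ i, hi⟩
  refine ⟨δ * γ, by positivity, fun m => ?_⟩
  calc δ * γ ≤ δ * ‖jacProd A ℓ x₀ m‖ := by gcongr; exact h m
    _ ≤ ‖WithLp.toLp 2 (jacProd A ℓ x₀ m *ᵥ x₀)‖ :=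
      mul_norm_le_norm_mulVec (fun i j => (jacProd_pos hA hℓ hx₀ m i j).le) hδ hle
    _ ≤ _ := by
      rw [← rawIter_succ_eq_jacProd_mulVec]
      exact norm_toLp_le_sum fun i => (rawIter_pos hA hℓ hx₀ _ i).le

/-- The orthogonal projection onto the vectors with coordinate sum zero. -/
noncomputable def projSumZero (n : ℕ) :
    EuclideanSpace ℝ (Fin n) →L[ℝ] EuclideanSpace ℝ (Fin n) :=
  (Submodule.span ℝ {(WithLp.toLp 2 fun _ => 1 : EuclideanSpace ℝ (Fin n))})ᗮ.starProjection

theorem sum_projSumZero {n : ℕ} (v : EuclideanSpace ℝ (Fin n)) : ∑ i, projSumZero n v i = 0 := by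
  have h : projSumZero n v ∈
      (Submodule.span ℝ {(WithLp.toLp 2 fun _ => 1 : EuclideanSpace ℝ (Fin n))})ᗮ :=
    Submodule.starProjection_apply_mem _ v
  rw [Submodule.mem_orthogonal_singleton_iff_inner_right] at h
  simpa [PiLp.inner_apply] using h

theorem norm_projSumZero_le {n : ℕ} (v : EuclideanSpace ℝ (Fin n)) : ‖projSumZero n v‖ ≤ ‖v‖ :=
  Submodule.norm_starProjection_apply_le _ v

theorem exists_eq_projSumZero_add {n : ℕ} (v : EuclideanSpace ℝ (Fin n)) :
    ∃ c : ℝ, v = projSumZero n v + WithLp.toLp 2 fun _ => c := by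
  have h : (Submodule.span ℝ
      {(WithLp.toLp 2 fun _ => 1 : EuclideanSpace ℝ (Fin n))}).starProjection v ∈ _ :=
    Submodule.starProjection_apply_mem _ v
  obtain ⟨c, hc⟩ := Submodule.mem_span_singleton.1 h
  refine ⟨c, ?_⟩
  have h2 := Submodule.starProjection_add_starProjection_orthogonal (K := (Submodule.span ℝ
      {(WithLp.toLp 2 fun _ => 1 : EuclideanSpace ℝ (Fin n))})) v
  rw [← hc, add_comm] at h2
  conv_lhs => rw [← h2]
  rw [projSumZero]
  congr 1
  ext i
  simp

theorem projSumZero_const {n : ℕ} (c : ℝ) : projSumZero n (WithLp.toLp 2 fun _ => c) = 0 := by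
  refine Submodule.starProjection_apply_eq_zero_iff _ |>.2 ?_
  rw [Submodule.orthogonal_orthogonal]
  refine Submodule.mem_span_singleton.2 ⟨c, ?_⟩
  ext i
  simp

theorem norm_toEuclideanLin_le {n : ℕ} (M : Matrix (Fin n) (Fin n) ℝ)
    (v : EuclideanSpace ℝ (Fin n)) : ‖Matrix.toEuclideanLin M v‖ ≤ ‖M‖ * ‖v‖ :=
  Matrix.l2_opNorm_mulVec M v

/-- The constant part of `v` is fixed by the power and then killed by the projection. -/
theorem norm_projSumZero_gram_pow_le {n : ℕ} {P : Matrix (Fin n) (Fin n) ℝ}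
    (hpos : ∀ i j, 0 < P i j) (hrow : ∀ i, ∑ j, P i j = 1) (hcol : ∀ j, ∑ i, P i j = 1) (k : ℕ)
    (v : EuclideanSpace ℝ (Fin n)) :
    ‖projSumZero n (Matrix.toEuclideanLin ((Pᵀ * P) ^ k) v)‖ ≤
      sigmaTwo P ^ (2 * k) * ‖projSumZero n v‖ := by
  obtain ⟨c, hc⟩ := exists_eq_projSumZero_add v
  conv_lhs => rw [hc]
  rw [map_add, map_add, gram_pow_const hrow hcol, projSumZero_const, add_zero]
  exact (norm_projSumZero_le _).trans
    (norm_gram_pow_le_sigmaTwo hpos hrow hcol k (sum_projSumZero v))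

/-- The matrix `D(x) - x xᵀ` kills constants because the entries of `x` sum to one, so only the
sum-zero part of `v` matters. -/
theorem norm_sub_sum_smul_le {n : ℕ} {x : Fin n → ℝ} (hsum : ∑ i, x i = 1)
    (v : EuclideanSpace ℝ (Fin n)) :
    ‖WithLp.toLp 2 (x * v.ofLp - (∑ i, x i * v i) • x)‖ ≤
      ‖Matrix.diagonal x - Matrix.vecMulVec x x‖ * ‖projSumZero n v‖ := by
  have h (u : EuclideanSpace ℝ (Fin n)) :
      Matrix.toEuclideanLin (Matrix.diagonal x - Matrix.vecMulVec x x) u =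
        WithLp.toLp 2 (x * u.ofLp - (∑ i, x i * u i) • x) := by
    ext i
    simp [Matrix.mulVec_diagonal, Matrix.vecMulVec_mulVec, dotProduct, mul_comm]
  obtain ⟨c, hc⟩ := exists_eq_projSumZero_add v
  rw [← h]
  conv_lhs => rw [hc]
  rw [map_add]
  have h0 : Matrix.toEuclideanLin (Matrix.diagonal x - Matrix.vecMulVec x x)
      (WithLp.toLp 2 fun _ => c) = 0 := by
    rw [h]
    ext i
    simp [← Finset.sum_mul, hsum]
    ring
  rw [h0, add_zero]
  exact norm_toEuclideanLin_le _ _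

theorem exists_norm_iter_sub_le {n : ℕ} {A : Matrix (Fin n) (Fin n) ℝ} (hA : ∀ i j, 0 < A i j)
    {ℓ : ℕ} (hℓ : 1 ≤ ℓ) {x₀ : Fin n → ℝ} (hx₀ : ∀ i, 0 < x₀ i)
    {x : Fin n → ℝ} (hx : ∀ i, 0 < x i) (hfix : opT A x = x) (hsum : ∑ i, x i = 1)
    (hE : ∃ η : ℝ, 0 < η ∧ ∃ E : ℕ → Matrix (Fin n) (Fin n) ℝ, ∀ k : ℕ,
      (jacobian A (iter A ℓ x₀ k)) ^ ℓ = (jacobian A x) ^ ℓ + E k ∧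
      ‖E k‖ ≤ η * sigmaTwo (balanced A x) ^ (2 * ℓ * k))
    (hprod : ∃ γ : ℝ, 0 < γ ∧ ∀ m : ℕ, γ ≤ ‖jacProd A ℓ x₀ m‖) :
    ∃ C : ℝ, ∀ k : ℕ, ‖WithLp.toLp 2 (iter A ℓ x₀ (k + 1) - x)‖ ≤
      C * ((k + 1) * (sigmaTwo (balanced A x) ^ (2 * ℓ)) ^ k) := by
  obtain ⟨η, hη, E, hE⟩ := hE
  obtain ⟨c, hc, hcw⟩ := exists_sum_rawIter_ge hA hℓ hx₀ hprod
  set P := balanced A x with hP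
  have hpos := balanced_pos hA hx
  have hrow := balanced_row_sum hA hx
  have hcol := balanced_col_sum hx hfix
  rw [← hP] at hpos hrow hcol
  have hσ0 : 0 ≤ sigmaTwo P := LinearMap.singularValues_nonneg _ _
  have hr0 : 0 ≤ sigmaTwo P ^ (2 * ℓ) := pow_nonneg hσ0 _
  have hr1 : sigmaTwo P ^ (2 * ℓ) < 1 :=
    pow_lt_one₀ hσ0 (sigmaTwo_lt_one hpos hrow hcol) (by omega)
  set w := rawIter A ℓ x₀ with hw
  -- Dividing by `x` turns the dominant eigenvector `x` into `e` and `J_T(x)` into the symmetric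
  -- `PᵀP`.
  let y : ℕ → EuclideanSpace ℝ (Fin n) := fun k => WithLp.toLp 2 (x⁻¹ * w k)
  have hxy (k : ℕ) : x * (y k).ofLp = w k := by
    ext i
    simp [y, mul_inv_cancel_left₀ (hx i).ne']
  have hconj : jacobian A x ^ ℓ * Matrix.diagonal x = Matrix.diagonal x * (Pᵀ * P) ^ ℓ := by
    have : SemiconjBy (Matrix.diagonal x) (Pᵀ * P) (jacobian A x) :=
      (jacobian_mul_diagonal hA hx hfix).symm
    exact (this.pow_right ℓ).symm
  let F : ℕ → Matrix (Fin n) (Fin n) ℝ := fun k =>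
    Matrix.diagonal x⁻¹ * E k * Matrix.diagonal x
  have hdiag (u v : Fin n → ℝ) : Matrix.diagonal u *ᵥ v = u * v := by
    ext i; simp [Matrix.mulVec_diagonal]
  have hinv : Matrix.diagonal x⁻¹ * Matrix.diagonal x = 1 := by
    rw [Matrix.diagonal_mul_diagonal, ← Matrix.diagonal_one]
    congr 1
    ext i
    simp [(hx i).ne']
  have hrec (k : ℕ) : y (k + 1) = Matrix.toEuclideanLin ((Pᵀ * P) ^ ℓ) (y k) +
      Matrix.toEuclideanLin (F k) (y k) := by
    rw [← LinearMap.add_apply, ← map_add]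
    have h1 : (Pᵀ * P) ^ ℓ + F k =
        Matrix.diagonal x⁻¹ * (jacobian A (iter A ℓ x₀ k)) ^ ℓ * Matrix.diagonal x := by
      rw [(hE k).1, Matrix.mul_add, Matrix.add_mul, Matrix.mul_assoc, hconj, ← Matrix.mul_assoc,
        hinv, Matrix.one_mul]
    rw [h1]
    apply (WithLp.ofLp_injective 2)
    rw [Matrix.ofLp_toLpLin, Matrix.toLin'_apply, ← Matrix.mulVec_mulVec, ← Matrix.mulVec_mulVec,
      hdiag, hdiag, hxy]
    rfl
  have hF (k : ℕ) : ‖Matrix.toEuclideanLin (F k) (y k)‖ ≤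
      (‖Matrix.diagonal x⁻¹‖ * η * ‖Matrix.diagonal x‖) * (sigmaTwo P ^ (2 * ℓ)) ^ k * ‖y k‖ := by
    refine (norm_toEuclideanLin_le _ _).trans ?_
    gcongr
    calc ‖F k‖ ≤ ‖Matrix.diagonal x⁻¹‖ * ‖E k‖ * ‖Matrix.diagonal x‖ :=
          (norm_mul_le _ _).trans (by gcongr; exact norm_mul_le _ _)
      _ ≤ ‖Matrix.diagonal x⁻¹‖ * (η * sigmaTwo P ^ (2 * ℓ * k)) * ‖Matrix.diagonal x‖ := by
          gcongr
          exact (hE k).2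
      _ = _ := by rw [pow_mul]; ring
  obtain ⟨C, hC, hRy⟩ := perturbed_power_iteration (R := projSumZero n) (map_add _)
    (by positivity) hr0 hr1 (norm_gram_pow_le hpos hrow hcol ℓ) norm_projSumZero_le
    (norm_projSumZero_gram_pow_le hpos hrow hcol ℓ) hrec hF
  refine ⟨c⁻¹ * (‖Matrix.diagonal x - Matrix.vecMulVec x x‖ * C), fun k => ?_⟩
  have hS := hcw k
  have hS0 := hc.trans_le hS
  -- Since `x * y = w`, the normalised error is `D(x) - x xᵀ` applied to `y`, divided by the sum of
  -- `w`.
  have h2 : WithLp.toLp 2 (iter A ℓ x₀ (k + 1) - x) = (∑ i, w (k + 1) i)⁻¹ •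
      WithLp.toLp 2 (x * (y (k + 1)).ofLp - (∑ i, x i * y (k + 1) i) • x) := by
    have h3 : ∑ i, x i * y (k + 1) i = ∑ i, w (k + 1) i := by
      rw [← hxy]; rfl
    rw [h3, hxy, iter_succ_eq_inv_sum_smul_rawIter hA hℓ hx₀, ← WithLp.toLp_smul, smul_sub,
      smul_smul, inv_mul_cancel₀ hS0.ne', one_smul]
  rw [h2, norm_smul, norm_inv, Real.norm_of_nonneg hS0.le]
  calc _ ≤ c⁻¹ * (‖Matrix.diagonal x - Matrix.vecMulVec x x‖ *
        (C * ((k + 1) * (sigmaTwo P ^ (2 * ℓ)) ^ k))) := by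
        gcongr
        refine (norm_sub_sum_smul_le hsum _).trans ?_
        gcongr
        exact hRy k
    _ = _ := by ring

end SKK

/-- Matrix norms are spectral norms (operator norms for the Euclidean norm). The upper limit is taken
in the extended reals. -/
theorem theorem2p6 {n : ℕ} (A : Matrix (Fin n) (Fin n) ℝ) (hA : ∀ i j, 0 < A i j)
    (ℓ : ℕ) (hℓ : 1 ≤ ℓ)
    (x₀ : Fin n → ℝ) (hx₀ : ∀ i, 0 < x₀ i)
    (x : Fin n → ℝ) (hx : ∀ i, 0 < x i) (hfix : SKK.opT A x = x) (hsum : ∑ i, x i = 1)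
    (hE : ∃ η : ℝ, 0 < η ∧ ∃ E : ℕ → Matrix (Fin n) (Fin n) ℝ, ∀ k : ℕ,
      (SKK.jacobian A (SKK.iter A ℓ x₀ k)) ^ ℓ = (SKK.jacobian A x) ^ ℓ + E k ∧
      ‖E k‖ ≤ η * SKK.sigmaTwo (SKK.balanced A x) ^ (2 * ℓ * k))
    (hprod : ∃ γ : ℝ, 0 < γ ∧ ∀ m : ℕ, γ ≤ ‖SKK.jacProd A ℓ x₀ m‖) :
    Tendsto (SKK.iter A ℓ x₀) atTop (𝓝 x) ∧
    limsup (fun k : ℕ =>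
        ((‖WithLp.toLp 2 (SKK.iter A ℓ x₀ k - x)‖ ^ (1 / (k : ℝ)) : ℝ) : EReal)) atTop
      ≤ ((SKK.sigmaTwo (SKK.balanced A x) ^ (2 * ℓ) : ℝ) : EReal) := by
  obtain ⟨C, hC⟩ := SKK.exists_norm_iter_sub_le hA hℓ hx₀ hx hfix hsum hE hprod
  have hσ0 : 0 ≤ SKK.sigmaTwo (SKK.balanced A x) := LinearMap.singularValues_nonneg _ _
  have hr1 : SKK.sigmaTwo (SKK.balanced A x) ^ (2 * ℓ) < 1 :=
    pow_lt_one₀ hσ0 (SKK.sigmaTwo_lt_one (SKK.balanced_pos hA hx) (SKK.balanced_row_sum hA hx)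
      (SKK.balanced_col_sum hx hfix)) (by omega)
  refine ⟨?_, SKK.limsup_root_le_of_le_linear_mul_geometric (fun _ => norm_nonneg _)
    (pow_nonneg hσ0 _) hC⟩
  have h := SKK.tendsto_zero_of_le_linear_mul_geometric
    (a := fun k => ‖WithLp.toLp 2 (SKK.iter A ℓ x₀ k - x)‖) (fun _ => norm_nonneg _)
    (pow_nonneg hσ0 _) hr1 hC
  have h1 : Tendsto (fun k => WithLp.ofLp (WithLp.toLp 2 (SKK.iter A ℓ x₀ k - x))) atTop (𝓝 0) :=
    ((PiLp.continuous_ofLp 2 fun _ : Fin n => ℝ).tendsto 0).comp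
      (tendsto_zero_iff_norm_tendsto_zero.2 h)
  exact tendsto_sub_nhds_zero_iff.1 h1
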